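/- For $n\ge 1$, $\beta\in\mathbb R$, a symmetric real $n\times n$ matrix $\mathbf Q$ with zero diagonal and $\pmb\mu\in\mathbb R^n$, let $\mathbb P_{\beta,\mathbf Q,\pmb\mu}$ be the Ising model on $\{-1,+1\}^n$ with $\mathbb P_{\beta,\mathbf Q,\pmb\mu}(\mathbf X=\mathbf x)\propto\exp\left(\frac\beta2\mathbf x^\top\mathbf Q\mathbf x+\pmb\mu^\top\mathbf x\right)$, and write $\mathrm{Var}_{\beta,\mathbf Q,\pmb\mu}$, $\mathrm{Cov}_{\beta,\mathbf Q,\pmb\mu}$ for its variances and covariances. Given a class $\mathcal C_n$ of subsets of $[n]$, all of size $s=s_n$, and $A=A_n\in\mathbb R$, let $\Xi(\mathcal C_n,s,A)$ be the set of $\pmb\mu\in\mathbb R_+^n$ with $\mathrm{supp}(\pmb\mu)\in\mathcal C_n$ and $\min_{i\in\mathrm{supp}(\pmb\mu)}\mu_i\ge A$. The risk of a test $T_n:\{-1,+1\}^n\to\{0,1\}$ of $H_0:\pmb\mu=\mathbf 0$ against $H_1:\pmb\mu\in\Xi(\mathcal C_n,s,A)$ is $$\mathrm{Risk}(T_n)=\mathbb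 P_{\beta,\mathbf Q,\mathbf 0}(T_n(\mathbf X)=1)+\sup_{\pmb\mu\in\Xi(\mathcal C_n,s,A)}\mathbb P_{\beta,\mathbf Q,\pmb\mu}(T_n(\mathbf X)=0).$$ A sequence $(T_n)$ is asymptotically powerful if $\limsup_n\mathrm{Risk}(T_n)=0$, asymptotically not powerful if $\liminf_n\mathrm{Risk}(T_n)>0$, and asymptotically powerless if $\liminf_n\mathrm{Risk}(T_n)\ge 1$ (that is, asymptotically no better than a trivial test). For $S\subseteq[n]$ let $\pmb\mu_S(\eta)$ be the vector equal to $\eta$ on $S$ and $0$ elsewhere. **Theorem.** For all constants $C_l,C_u'>0$ there exist constants $c',C>0$ such that the following holds for all sequences $\beta=\beta_n$, $\mathbf Q=\mathbf Q_n$ (symmetric with zero diagonal), $s=s_n$, $A=A_n$ and $\mathcal C_n$ as above with $\min_{i,j}\beta\mathbf Q_{ij}\ge 0$ and $\|\mathbf Q\|_{\infty\to\infty}\le C_u'$ for all $n$, and all subclasses $\mathcal C_n'\subseteq\mathcal C_n$ of pairwise disjoint sets with $\log|\mathcal C_n'|\ge C_l\log n$ for all large $n$. (I) Let $r_n,r_n'\to+\infty$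 be sequences such that, for all large $n$, $r_n\ge C\log n$ and $\sup_{S\in\mathcal C_n'}\mathrm{Var}_{\beta,\mathbf Q,\mathbf 0}\left(\sum_{i\in S}X_i\right)\le r_n$, and such that $\sup_{S_1\ne S_2\in\mathcal C_n'}\mathrm{Cov}_{\beta,\mathbf Q,\mathbf 0}\left(\sum_{i\in S_1}X_i,\sum_{j\in S_2}X_j\right)=o(r_n')$. If $\tanh(A)\le c'\min\left\{\sqrt{\log n/r_n},\sqrt{1/r_n'}\right\}$ for all large $n$, then every sequence of tests is asymptotically powerless, and moreover $\liminf_n\inf_{T_n}\mathrm{Risk}(T_n)=1$, the infimum being over all tests. (II) Let $\Omega_n\subseteq\{-1,+1\}^n$ be increasing sets, $\kappa>0$ a constant, and $r_n,r_n'\to+\infty$ sequences with $r_n\ge C\log n$ for all large $n$, such that - $\sup_{\eta\in[0,A]}\sup_{S\in\mathcal C_n'}\mathrm{Var}_{\beta,\mathbf Q,\pmb\mu_S(2\eta)}\left(\sum_{i\in S}X_i\,\middle|\,\Omega_n\right)\le r_n$ for all large $n$; - $\sup_{\eta\in[0,A]}\sup_{S_1\ne S_2\in\mathcal C_n'}\left|\mathrm{Var}_{\beta,\mathbf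 Q,\pmb\mu_{S_1\cup S_2}(\eta)}\left(\sum_{i\in S_1\cup S_2}X_i\,\middle|\,\Omega_n\right)-\mathrm{Var}_{\beta,\mathbf Q,\pmb\mu_{S_1}(\eta)}\left(\sum_{i\in S_1}X_i\,\middle|\,\Omega_n\right)-\mathrm{Var}_{\beta,\mathbf Q,\pmb\mu_{S_2}(\eta)}\left(\sum_{i\in S_2}X_i\,\middle|\,\Omega_n\right)\right|=o(r_n')$; - $\liminf_{n\to\infty}\mathbb P_{\beta,\mathbf Q,\mathbf 0}(\Omega_n)\ge\kappa$. If $\tanh(A)\le c'\min\left\{\sqrt{\log n/r_n},\sqrt{1/r_n'}\right\}$ for all large $n$, then no sequence of tests is asymptotically powerful; indeed every sequence of tests is asymptotically not powerful. -/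

import Mathlib

open Filter Topology

noncomputable section

namespace IsingDetection

/-- Spin configurations `x ∈ {-1,+1}ⁿ`, with the coordinatewise order. -/
abbrev Spins (n : ℕ) : Type := Fin n → ℤˣ

/-- The configuration `x` as a vector of `ℝⁿ`. -/
def spinVec {n : ℕ} (x : Spins n) : Fin n → ℝ := fun i => ((x i : ℤ) : ℝ)

/-- Unnormalized Gibbs weight `exp((β/2) xᵀ Q x + μᵀ x)`. -/
def weight {n : ℕ} (β : ℝ) (Q : Matrix (Fin n) (Fin n) ℝ) (μ : Fin n → ℝ) (x : Spins n) : ℝ :=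
  Real.exp (β / 2 * (spinVec x ⬝ᵥ Q.mulVec (spinVec x)) + μ ⬝ᵥ spinVec x)

/-- The normalizing constant `Z_n(β, Q, μ)`. -/
def partitionFn {n : ℕ} (β : ℝ) (Q : Matrix (Fin n) (Fin n) ℝ) (μ : Fin n → ℝ) : ℝ :=
  ∑ x : Spins n, weight β Q μ x

/-- Expectation of `f(X)` for `X` from the Ising model with parameters `β, Q, μ`. -/
def expect {n : ℕ} (β : ℝ) (Q : Matrix (Fin n) (Fin n) ℝ) (μ : Fin n → ℝ)
    (f : Spins n → ℝ) : ℝ :=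
  ∑ x : Spins n, weight β Q μ x / partitionFn β Q μ * f x

/-- Probability of the event `X ∈ E` under the Ising model. -/
def prob {n : ℕ} (β : ℝ) (Q : Matrix (Fin n) (Fin n) ℝ) (μ : Fin n → ℝ)
    (E : Set (Spins n)) : ℝ :=
  expect β Q μ (E.indicator 1)

/-- Covariance of `f(X)` and `g(X)` under the Ising model. -/
def cov {n : ℕ} (β : ℝ) (Q : Matrix (Fin n) (Fin n) ℝ) (μ : Fin n → ℝ)
    (f g : Spins n → ℝ) : ℝ :=
  expect β Q μ (fun x => (f x - expect β Q μ f) * (g x - expect β Q μ g))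

/-- Variance of `f(X)` under the Ising model. -/
def var {n : ℕ} (β : ℝ) (Q : Matrix (Fin n) (Fin n) ℝ) (μ : Fin n → ℝ)
    (f : Spins n → ℝ) : ℝ :=
  cov β Q μ f f

/-- Conditional expectation of `f(X)` given the event `X ∈ Ω`. -/
def condExpect {n : ℕ} (β : ℝ) (Q : Matrix (Fin n) (Fin n) ℝ) (μ : Fin n → ℝ)
    (Ω : Set (Spins n)) (f : Spins n → ℝ) : ℝ :=
  expect β Q μ (Ω.indicator f) / prob β Q μ Ω

/-- Conditional variance of `f(X)` given the event `X ∈ Ω`. -/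
def condVar {n : ℕ} (β : ℝ) (Q : Matrix (Fin n) (Fin n) ℝ) (μ : Fin n → ℝ)
    (Ω : Set (Spins n)) (f : Spins n → ℝ) : ℝ :=
  condExpect β Q μ Ω (fun x => (f x - condExpect β Q μ Ω f) ^ 2)

/-- The block sum `∑_{i ∈ S} X_i`. -/
def blockSum {n : ℕ} (S : Finset (Fin n)) (x : Spins n) : ℝ := ∑ i ∈ S, spinVec x i

/-- The vector `μ_S(η)`, equal to `η` on `S` and to `0` off `S`. -/
def blockField {n : ℕ} (S : Finset (Fin n)) (η : ℝ) : Fin n → ℝ :=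
  fun i => if i ∈ S then η else 0

/-- The `ℓ∞ → ℓ∞` operator norm of `Q` (here `Fin n → ℝ` carries the sup norm). -/
def inftyOpNorm {n : ℕ} (Q : Matrix (Fin n) (Fin n) ℝ) : ℝ :=
  ‖LinearMap.toContinuousLinearMap (Matrix.toLin' Q)‖

/-- The support of a vector. -/
def supp {n : ℕ} (μ : Fin n → ℝ) : Finset (Fin n) := Finset.univ.filter (fun i => μ i ≠ 0)

/-- The alternatives: nonnegative vectors whose support lies in the class `𝒞` and whose
nonzero entries are at least `A`. -/
def alternatives {n : ℕ} (𝒞 : Finset (Finset (Fin n))) (A : ℝ) : Set (Fin n → ℝ) :=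
  {μ | (∀ i, 0 ≤ μ i) ∧ supp μ ∈ 𝒞 ∧ ∀ i ∈ supp μ, A ≤ μ i}

/-- A test: a `{0,1}`-valued function of the data, `1` meaning rejection. -/
abbrev Test (n : ℕ) : Type := Spins n → Fin 2

/-- Worst case risk: type I error plus the supremum of the type II errors. -/
def risk {n : ℕ} (β : ℝ) (Q : Matrix (Fin n) (Fin n) ℝ) (𝒞 : Finset (Finset (Fin n))) (A : ℝ)
    (T : Test n) : ℝ :=
  prob β Q 0 {x | T x = 1} + ⨆ μ : alternatives 𝒞 A, prob β Q (μ : Fin n → ℝ) {x | T x = 0}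

/-- A sequence of tests with risks `R n` is asymptotically powerful. -/
def AsympPowerful (R : ℕ → ℝ) : Prop := limsup R atTop = 0

/-- A sequence of tests with risks `R n` is asymptotically not powerful. -/
def AsympNotPowerful (R : ℕ → ℝ) : Prop := 0 < liminf R atTop

/-- A sequence of tests with risks `R n` is asymptotically powerless: it does asymptotically no
better than a trivial test. (A perverse test may well have risk larger than `1`.) -/
def AsympPowerless (R : ℕ → ℝ) : Prop := 1 ≤ liminf R atTop

end IsingDetection

end

/-! The minimax risk is at least the average risk under the uniform prior on the fields `blockField
S A`, `S ∈ 𝒞'`. The second moment method bounds the latter: if `g` is the likelihood ratio of the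
mixture against the null, Cauchy-Schwarz shows that the two errors add up to at least `1 - √(Var g)`
(`one_sub_le_error_sum`).

The second moment is an average over pairs of blocks of ratios of partition functions. A field on
`S` is an exponential tilt, so the log partition function has the mean as first and the variance as
second derivative in the field strength. Taylor expansion then bounds a diagonal ratio by `exp (2 A²
r)` (`sum_tilt_double_le`) and an off-diagonal one by `exp (m A² / 2)`, where `m` bounds the excess
of the variance of the union over the two separate variances (`sum_tilt_add_le`). The diagonal pairs
have weight `1 / |𝒞'| ≤ n ^ (-Cl)`, which beats the first exponential; the second tends to `1`.

All this is done for the measure restricted to an event `Ω`. For increasing `Ω`, FKG gives `P_μ(Ω) ≥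
P_0(Ω)`, so passing back to the full measure costs only the factor `P_0(Ω)`
(`prob_mul_one_sub_le_risk`). This is part (II).

Part (I) takes `Ω` to be everything. Its hypotheses concern zero field only, and the GHS inequality
(`wcum3_weight_nonpos`) transfers them to positive fields: covariances of block sums decrease as the
field grows. -/

noncomputable section

namespace IsingDetection

/-! ### Exponential tilts and the second moment method on a finite space -/

section ExponentialFamily

variable {X : Type*}

/-- Exponential tilting of the weights `w` in the direction `φ`. -/
def tilt (w φ : X → ℝ) (t : ℝ) : X → ℝ := fun x => w x * Real.exp (t * φ x)

lemma tilt_nonneg {w : X → ℝ} (hw : 0 ≤ w) (φ : X → ℝ) (t : ℝ) : 0 ≤ tilt w φ t :=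
  fun x => mul_nonneg (hw x) (Real.exp_pos _).le

lemma tilt_zero (w φ : X → ℝ) : tilt w φ 0 = w := by
  funext x; simp [tilt]

variable [Fintype X]

/-- Mean of `f` under the probability measure proportional to the weights `w`. -/
def wmean (w f : X → ℝ) : ℝ := (∑ x, w x * f x) / ∑ x, w x

/-- Covariance of `f` and `g` under the probability measure proportional to `w`. -/
def wcov (w f g : X → ℝ) : ℝ := wmean w (f * g) - wmean w f * wmean w g

/-- Third joint cumulant under the probability measure proportional to `w`. -/
def wcum3 (w f g h : X → ℝ) : ℝ :=
  wmean w (f * g * h) - wmean w (f * g) * wmean w h - wmean w (f * h) * wmean w g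
    - wmean w (g * h) * wmean w f + 2 * (wmean w f * wmean w g * wmean w h)

lemma sum_tilt_pos {w : X → ℝ} (hw : 0 ≤ w) (hs : 0 < ∑ x, w x) (φ : X → ℝ) (t : ℝ) :
    0 < ∑ x, tilt w φ t x := by
  obtain ⟨x, -, hx⟩ : ∃ x ∈ Finset.univ, 0 < w x := by
    by_contra! h
    exact absurd hs (not_lt.2 (Finset.sum_nonpos h))
  exact Finset.sum_pos' (fun y _ => tilt_nonneg hw φ t y)
    ⟨x, Finset.mem_univ _, mul_pos hx (Real.exp_pos _)⟩

lemma wmean_add (w f g : X → ℝ) : wmean w (f + g) = wmean w f + wmean w g := by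
  simp [wmean, mul_add, Finset.sum_add_distrib, add_div]

lemma wmean_mul_left (w f : X → ℝ) (c : ℝ) : wmean w (fun x => c * f x) = c * wmean w f := by
  simp only [wmean, mul_left_comm _ c, ← Finset.mul_sum, mul_div_assoc]

lemma wmean_const {w : X → ℝ} (hs : ∑ x, w x ≠ 0) (c : ℝ) : wmean w (fun _ => c) = c := by
  simp only [wmean, ← Finset.sum_mul]
  field_simp

lemma wmean_nonneg {w f : X → ℝ} (hw : 0 ≤ w) (hf : 0 ≤ f) : 0 ≤ wmean w f :=
  div_nonneg (Finset.sum_nonneg fun x _ => mul_nonneg (hw x) (hf x))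
    (Finset.sum_nonneg fun x _ => hw x)

lemma wmean_centered {w : X → ℝ} (hs : ∑ x, w x ≠ 0) (f g : X → ℝ) :
    wmean w (fun x => (f x - wmean w f) * (g x - wmean w g)) = wcov w f g := by
  have h : (fun x => (f x - wmean w f) * (g x - wmean w g))
      = f * g + ((fun x => (-wmean w g) * f x) + ((fun x => (-wmean w f) * g x)
        + fun _ => wmean w f * wmean w g)) := by
    funext x; simp only [Pi.add_apply, Pi.mul_apply]; ring
  rw [h, wmean_add, wmean_add, wmean_add, wmean_mul_left, wmean_mul_left, wmean_const hs, wcov]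
  ring

lemma wcov_self_nonneg {w : X → ℝ} (hw : 0 ≤ w) (hs : ∑ x, w x ≠ 0) (f : X → ℝ) :
    0 ≤ wcov w f f := by
  rw [← wmean_centered hs]
  exact wmean_nonneg hw fun x => mul_self_nonneg _

lemma wcov_comm (w f g : X → ℝ) : wcov w f g = wcov w g f := by
  simp only [wcov, mul_comm]

lemma wcov_add_left (w f g h : X → ℝ) : wcov w (f + g) h = wcov w f h + wcov w g h := by
  simp only [wcov, add_mul, wmean_add]; ring

lemma wcov_add_self (w f g : X → ℝ) :
    wcov w (f + g) (f + g) = wcov w f f + wcov w g g + 2 * wcov w f g := by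
  rw [wcov_add_left, wcov_comm w f, wcov_comm w g, wcov_add_left, wcov_add_left, wcov_comm w g f]
  ring

lemma hasDerivAt_sum_tilt_mul (w φ f : X → ℝ) (t : ℝ) :
    HasDerivAt (fun t => ∑ x, tilt w φ t x * f x) (∑ x, tilt w φ t x * (φ * f) x) t := by
  refine HasDerivAt.fun_sum fun x _ => ?_
  have h1 : HasDerivAt (fun t : ℝ => t * φ x) (φ x) t := by
    simpa using (hasDerivAt_id t).mul_const (φ x)
  have h := (h1.exp.const_mul (w x)).mul_const (f x)
  refine h.congr_deriv ?_
  simp only [tilt, Pi.mul_apply]; ring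

lemma hasDerivAt_sum_tilt (w φ : X → ℝ) (t : ℝ) :
    HasDerivAt (fun t => ∑ x, tilt w φ t x) (∑ x, tilt w φ t x * φ x) t := by
  simpa using hasDerivAt_sum_tilt_mul w φ 1 t

variable {w : X → ℝ}

lemma hasDerivAt_log_sum_tilt (hw : 0 ≤ w) (hs : 0 < ∑ x, w x) (φ : X → ℝ) (t : ℝ) :
    HasDerivAt (fun t => Real.log (∑ x, tilt w φ t x)) (wmean (tilt w φ t) φ) t :=
  (hasDerivAt_sum_tilt w φ t).log (sum_tilt_pos hw hs φ t).ne'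

lemma hasDerivAt_wmean_tilt (hw : 0 ≤ w) (hs : 0 < ∑ x, w x) (φ f : X → ℝ) (t : ℝ) :
    HasDerivAt (fun t => wmean (tilt w φ t) f) (wcov (tilt w φ t) φ f) t := by
  have hp := (sum_tilt_pos hw hs φ t).ne'
  have h := (hasDerivAt_sum_tilt_mul w φ f t).div (hasDerivAt_sum_tilt w φ t) hp
  refine h.congr_deriv ?_
  simp only [wcov, wmean]
  field_simp

lemma hasDerivAt_wcov_tilt (hw : 0 ≤ w) (hs : 0 < ∑ x, w x) (φ f g : X → ℝ) (t : ℝ) :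
    HasDerivAt (fun t => wcov (tilt w φ t) f g) (wcum3 (tilt w φ t) f g φ) t := by
  have h := (hasDerivAt_wmean_tilt hw hs φ (f * g) t).sub
    ((hasDerivAt_wmean_tilt hw hs φ f t).mul (hasDerivAt_wmean_tilt hw hs φ g t))
  refine h.congr_deriv ?_
  have e : φ * (f * g) = f * g * φ := by ring
  simp only [wcov, wcum3, e, mul_comm φ f, mul_comm φ g]
  ring

/-- A second order Taylor bound with vanishing initial data. -/
lemma taylor_two_le {G G' G'' : ℝ → ℝ} (h1 : ∀ t, HasDerivAt G (G' t) t)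
    (h2 : ∀ t, HasDerivAt G' (G'' t) t) (h0 : G 0 = 0) (h0' : G' 0 = 0) {a M : ℝ} (ha : 0 ≤ a)
    (hM : ∀ t ∈ Set.Icc 0 a, G'' t ≤ M) : G a ≤ M * a ^ 2 / 2 := by
  have key : ∀ {K K' : ℝ → ℝ}, (∀ t, HasDerivAt K (K' t) t) → K 0 = 0 →
      (∀ t ∈ Set.Icc 0 a, 0 ≤ K' t) → ∀ t ∈ Set.Icc 0 a, 0 ≤ K t := by
    intro K K' hK hK0 hn t ht
    have hm : MonotoneOn K (Set.Icc 0 a) := by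
      refine monotoneOn_of_deriv_nonneg (convex_Icc 0 a)
        (fun x _ => (hK x).continuousAt.continuousWithinAt)
        (fun x _ => (hK x).differentiableAt.differentiableWithinAt) fun x hx => ?_
      rw [(hK x).deriv]
      exact hn x (interior_subset hx)
    have := hm ⟨le_rfl, ha⟩ ht ht.1
    rwa [hK0] at this
  have hG' : ∀ t ∈ Set.Icc 0 a, 0 ≤ M * t - G' t := by
    refine key (K' := fun t => M - G'' t) (fun t => ?_) (by simp [h0'])
      fun t ht => sub_nonneg.2 (hM t ht)
    exact (((hasDerivAt_id t).const_mul M).sub (h2 t)).congr_deriv (by simp)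
  have hG : ∀ t ∈ Set.Icc 0 a, 0 ≤ M * t ^ 2 / 2 - G t := by
    refine key (K' := fun t => M * t - G' t) (fun t => ?_) (by simp [h0]) hG'
    have h := ((((hasDerivAt_id t).pow 2).const_mul M).div_const 2).sub (h1 t)
    exact h.congr_deriv (by simp; ring)
  linarith [hG a ⟨ha, le_rfl⟩]

/-- Same-direction bound for the ratios in the second moment. -/
lemma sum_tilt_double_le (hw : 0 ≤ w) (hs : 0 < ∑ x, w x) (φ : X → ℝ) {a r : ℝ} (ha : 0 ≤ a)
    (hr : ∀ t ∈ Set.Icc 0 a, wcov (tilt w φ (2 * t)) φ φ ≤ r) :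
    (∑ x, w x) * (∑ x, tilt w φ (2 * a) x)
      ≤ Real.exp (2 * a ^ 2 * r) * ((∑ x, tilt w φ a x) * ∑ x, tilt w φ a x) := by
  have hF := hasDerivAt_log_sum_tilt hw hs φ
  have hF' := hasDerivAt_wmean_tilt hw hs φ φ
  have hd : ∀ t : ℝ, HasDerivAt (fun t : ℝ => 2 * t) 2 t := fun t => by
    simpa using (hasDerivAt_id t).const_mul 2
  set F := fun t => Real.log (∑ x, tilt w φ t x) with hFdef
  -- Second difference of the log partition function over `0, a, 2a`. Its second derivative is four
  -- times the variance at `2t` minus twice that at `t`; the latter is dropped by nonnegativity.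
  have h := taylor_two_le (a := a) (M := 4 * r)
    (G := fun t => F (2 * t) - 2 * F t + F 0)
    (G' := fun t => wmean (tilt w φ (2 * t)) φ * 2 - 2 * wmean (tilt w φ t) φ)
    (G'' := fun t => wcov (tilt w φ (2 * t)) φ φ * 2 * 2 - 2 * wcov (tilt w φ t) φ φ)
    (fun t => (((hF (2 * t)).comp t (hd t)).sub ((hF t).const_mul 2)).add_const _)
    (fun t => (((hF' (2 * t)).comp t (hd t)).mul_const 2).sub ((hF' t).const_mul 2))
    (by simp; ring) (by simp; ring) ha
    (fun t ht => by
      have h1 := hr t ht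
      have h2 := wcov_self_nonneg (tilt_nonneg hw φ t) (sum_tilt_pos hw hs φ t).ne' φ
      linarith)
  have p0 : 0 < ∑ x, tilt w φ 0 x := sum_tilt_pos hw hs φ 0
  have p1 := sum_tilt_pos hw hs φ a
  have p2 := sum_tilt_pos hw hs φ (2 * a)
  rw [tilt_zero] at p0
  rw [← Real.log_le_log_iff (by positivity) (by positivity), Real.log_mul p0.ne' p2.ne',
    Real.log_mul (Real.exp_pos _).ne' (by positivity), Real.log_mul p1.ne' p1.ne', Real.log_exp]
  simp only [hFdef, tilt_zero] at h
  linarith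

/-- Mixed-direction bound for the ratios in the second moment. -/
lemma sum_tilt_add_le (hw : 0 ≤ w) (hs : 0 < ∑ x, w x) (φ ψ : X → ℝ) {a m : ℝ} (ha : 0 ≤ a)
    (hm : ∀ t ∈ Set.Icc 0 a, wcov (tilt w (φ + ψ) t) (φ + ψ) (φ + ψ)
      - wcov (tilt w φ t) φ φ - wcov (tilt w ψ t) ψ ψ ≤ m) :
    (∑ x, w x) * (∑ x, tilt w (φ + ψ) a x)
      ≤ Real.exp (m * a ^ 2 / 2) * ((∑ x, tilt w φ a x) * ∑ x, tilt w ψ a x) := by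
  have h := taylor_two_le (a := a) (M := m)
    (fun t => (((hasDerivAt_log_sum_tilt hw hs (φ + ψ) t).sub
      (hasDerivAt_log_sum_tilt hw hs φ t)).sub
        (hasDerivAt_log_sum_tilt hw hs ψ t)).add_const (Real.log (∑ x, w x)))
    (fun t => ((hasDerivAt_wmean_tilt hw hs (φ + ψ) (φ + ψ) t).sub
      (hasDerivAt_wmean_tilt hw hs φ φ t)).sub (hasDerivAt_wmean_tilt hw hs ψ ψ t))
    (by simp [tilt_zero]) (by simp [tilt_zero, wmean_add]) ha hm
  have p1 := sum_tilt_pos hw hs φ a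
  have p2 := sum_tilt_pos hw hs ψ a
  have p3 := sum_tilt_pos hw hs (φ + ψ) a
  rw [← Real.log_le_log_iff (by positivity) (by positivity), Real.log_mul hs.ne' p3.ne',
    Real.log_mul (Real.exp_pos _).ne' (by positivity), Real.log_mul p1.ne' p2.ne', Real.log_exp]
  simp only [Pi.sub_apply] at h
  linarith

/-- The second moment method: mixture of tilts against the untilted measure. -/
lemma one_sub_le_error_sum {ι : Type*} (s : Finset ι) (hN : s.Nonempty) (hw : 0 ≤ w)
    (hs : 0 < ∑ x, w x) (φ : ι → X → ℝ) (a : ℝ) {D δ : ℝ}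
    (hD : ∀ i ∈ s, (∑ x, w x) * (∑ x, tilt w (φ i) (2 * a) x)
      ≤ D * ((∑ x, tilt w (φ i) a x) * ∑ x, tilt w (φ i) a x))
    (hδ0 : 0 ≤ δ)
    (hδ : ∀ i ∈ s, ∀ j ∈ s, i ≠ j → (∑ x, w x) * (∑ x, tilt w (φ i + φ j) a x)
      ≤ (1 + δ) * ((∑ x, tilt w (φ i) a x) * ∑ x, tilt w (φ j) a x))
    (E : Set X) :
    1 - √(D / s.card + δ) ≤ wmean w (Eᶜ.indicator 1)
      + (∑ i ∈ s, wmean (tilt w (φ i) a) (E.indicator 1)) / s.card := by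
  classical
  set Z := ∑ x, w x with hZ
  set N : ℝ := (s.card : ℝ) with hNdef
  have hNpos : 0 < N := by rw [hNdef]; exact_mod_cast hN.card_pos
  set z : ι → ℝ := fun i => ∑ x, tilt w (φ i) a x with hz
  have hzp : ∀ i, 0 < z i := fun i => sum_tilt_pos hw hs (φ i) a
  have hD0 : 0 ≤ D := by
    obtain ⟨i, hi⟩ := hN
    have h1 := hD i hi
    have h2 := mul_pos hs (sum_tilt_pos hw hs (φ i) (2 * a))
    have h3 := mul_pos (hzp i) (hzp i)
    by_contra! hneg
    nlinarith
  -- `L i` is the density of the `i`-th normalized tilt with respect to normalized `w`; `g` below is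
  -- the density of the uniform mixture.
  set L : ι → X → ℝ := fun i x => Real.exp (a * φ i x) * Z / z i with hL
  have hwL : ∀ i x, w x * L i x = Z * (tilt w (φ i) a x / z i) := by
    intro i x; simp only [hL, tilt]; ring
  set g : X → ℝ := fun x => (∑ i ∈ s, L i x) / N with hg
  have hmean : ∀ f : X → ℝ,
      wmean w (g * f) = (∑ i ∈ s, wmean (tilt w (φ i) a) f) / N := by
    intro f
    simp only [wmean, hg, Pi.mul_apply]
    rw [← hZ, div_eq_div_iff hs.ne' hNpos.ne', Finset.sum_mul, Finset.sum_mul]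
    calc ∑ x, w x * ((∑ i ∈ s, L i x) / N * f x) * N
        = ∑ x, ∑ i ∈ s, (w x * L i x) * f x := by
          refine Finset.sum_congr rfl fun x _ => ?_
          rw [← Finset.sum_mul, ← Finset.mul_sum]
          field_simp
      _ = ∑ i ∈ s, (∑ x, tilt w (φ i) a x * f x) / z i * Z := by
          rw [Finset.sum_comm]
          refine Finset.sum_congr rfl fun i _ => ?_
          rw [Finset.sum_div, Finset.sum_mul]
          refine Finset.sum_congr rfl fun x _ => ?_
          rw [hwL]; ring
  have hg1 : wmean w g = 1 := by
    have h := hmean 1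
    have h1 : ∀ i ∈ s, wmean (tilt w (φ i) a) 1 = 1 := fun i _ => wmean_const (hzp i).ne' 1
    rw [mul_one, Finset.sum_congr rfl h1] at h
    rw [h, Finset.sum_const, nsmul_one, ← hNdef, div_self hNpos.ne']
  have hg2 : wmean w (g * g) ≤ D / N + (1 + δ) := by
    have hprod : ∀ i j, ∀ x, tilt w (φ i) a x * L j x
        = Z / z j * tilt w (φ i + φ j) a x := by
      intro i j x
      simp only [hL, tilt, Pi.add_apply, mul_add, Real.exp_add]; ring
    -- On the diagonal `D` alone would do; the spare `1 + δ` makes the double sum collapse to `D / N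
    -- + (1 + δ)` exactly.
    have hbound : ∀ i ∈ s, ∀ j ∈ s, wmean (tilt w (φ i) a) (L j)
        ≤ (if i = j then D else 0) + (1 + δ) := by
      intro i hi j hj
      have e : wmean (tilt w (φ i) a) (L j)
          = Z * (∑ x, tilt w (φ i + φ j) a x) / (z i * z j) := by
        simp only [wmean, hprod, ← Finset.mul_sum]
        simp only [hz]
        rw [div_mul_eq_mul_div, div_div, mul_comm (∑ x, tilt w (φ j) a x)]
      rw [e, div_le_iff₀ (mul_pos (hzp i) (hzp j))]
      split_ifs with hij
      · subst hij
        have e2 : tilt w (φ i + φ i) a = tilt w (φ i) (2 * a) := by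
          funext x; simp only [tilt, Pi.add_apply]; congr 2; ring
        rw [e2]
        have := hD i hi
        have h3 := mul_pos (hzp i) (hzp i)
        nlinarith
      · simpa using hδ i hi j hj hij
    rw [hmean, div_le_iff₀ hNpos]
    calc ∑ i ∈ s, wmean (tilt w (φ i) a) g
        = ∑ i ∈ s, (∑ j ∈ s, wmean (tilt w (φ i) a) (L j)) / N := by
          refine Finset.sum_congr rfl fun i _ => ?_
          simp only [wmean, hg]
          rw [← Finset.sum_div, Finset.sum_comm, div_right_comm]
          congr 1
          rw [Finset.sum_div]
          refine Finset.sum_congr rfl fun x _ => ?_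
          rw [← Finset.mul_sum]; ring
      _ ≤ ∑ i ∈ s, (∑ j ∈ s, ((if i = j then D else 0) + (1 + δ))) / N := by
          refine Finset.sum_le_sum fun i hi => ?_
          gcongr with j hj
          exact hbound i hi j hj
      _ = (D / N + (1 + δ)) * N := by
          have h4 : ∀ i ∈ s, (∑ j ∈ s, ((if i = j then D else 0) + (1 + δ))) / N
              = D / N + (1 + δ) := by
            intro i hi
            rw [Finset.sum_add_distrib, Finset.sum_ite_eq, if_pos hi, Finset.sum_const,
              nsmul_eq_mul, ← hNdef]
            field_simp
          rw [Finset.sum_congr rfl h4, Finset.sum_const, nsmul_eq_mul, mul_comm]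
  rw [← hmean]
  -- Cauchy-Schwarz for `1 - g` against the indicator of `E`.
  set e : X → ℝ := E.indicator 1 with he
  have hee : ∀ x, e x * e x = e x := by
    intro x; by_cases hx : x ∈ E <;> simp [he, hx]
  have hel : ∀ x, e x ≤ 1 := by
    intro x; by_cases hx : x ∈ E <;> simp [he, hx]
  have hcompl : Eᶜ.indicator (1 : X → ℝ) = (fun _ => 1) + fun x => (-1) * e x := by
    funext x; by_cases hx : x ∈ E <;> simp [he, hx]
  rw [hcompl, wmean_add, wmean_const hs.ne', wmean_mul_left]
  set v := wmean w (fun x => (g x - 1) * e x) with hv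
  have hveq : wmean w (g * e) = v + wmean w e := by
    rw [hv, ← wmean_add]; congr 1; funext x; simp; ring
  have hvar : wmean w (fun x => (g x - 1) * (g x - 1)) = wmean w (g * g) - 1 := by
    have := wmean_centered hs.ne' g g
    rw [hg1] at this
    rw [this, wcov, hg1, one_mul]
  -- Nonnegativity of the variance of `(g - 1) * e` bounds `v ^ 2` by its second moment, and `e * e
  -- = e ≤ 1` bounds that by the variance of `g`.
  have hsq : v ^ 2 ≤ D / N + δ := by
    have hQ : 0 ≤ wmean w (fun x => ((g x - 1) * e x - v) * ((g x - 1) * e x - v)) :=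
      wmean_nonneg hw fun x => mul_self_nonneg _
    rw [hv, wmean_centered hs.ne' (fun x => (g x - 1) * e x), wcov, ← hv] at hQ
    have hle : wmean w ((fun x => (g x - 1) * e x) * fun x => (g x - 1) * e x)
        ≤ wmean w (fun x => (g x - 1) * (g x - 1)) := by
      unfold wmean
      gcongr with x
      · exact hw x
      · have := hee x
        have h5 := mul_nonneg (mul_self_nonneg (g x - 1)) (sub_nonneg.2 (hel x))
        simp only [Pi.mul_apply]
        nlinarith
    nlinarith
  have habs : -v ≤ √(D / N + δ) := by
    apply Real.le_sqrt_of_sq_le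
    nlinarith
  rw [hveq]
  linarith

end ExponentialFamily

/-! ### Four replicas: positivity after rotation, and the GHS inequality -/

section Replica

/-- A sign matrix, orthogonal up to the factor `2`, rotating four replicas. -/
def replicaSign : Fin 4 → Fin 4 → ℝ :=
  ![![1, 1, 1, 1], ![1, 1, -1, -1], ![1, -1, 1, -1], ![-1, 1, 1, -1]]

/-- The `k`-th rotated variable of the four spins at one site. -/
def rotated (k : Fin 4) (s : Fin 4 → ℤˣ) : ℝ := ∑ a, replicaSign k a * ((s a : ℤ) : ℝ)

/-- The columns of `replicaSign` are orthogonal of squared norm `4`. Hence a ferromagnetic pair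
interaction keeps nonnegative coefficients in the rotated variables. -/
lemma sum_rotated_mul_rotated (s t : Fin 4 → ℤˣ) :
    ∑ k, rotated k s * rotated k t = 4 * ∑ a, ((s a : ℤ) : ℝ) * ((t a : ℤ) : ℝ) := by
  simp [rotated, replicaSign, Fin.sum_univ_four]
  ring

/-- A four-tuple is a function on `Fin 4`. -/
def quadEquiv (α : Type*) : (α × α × α × α) ≃ (Fin 4 → α) where
  toFun p := ![p.1, p.2.1, p.2.2.1, p.2.2.2]
  invFun f := (f 0, f 1, f 2, f 3)
  left_inv _ := rfl
  right_inv f := by ext i; fin_cases i <;> rfl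

lemma sum_intUnits {M : Type*} [AddCommMonoid M] (f : ℤˣ → M) : ∑ u, f u = f 1 + f (-1) := by
  have : (Finset.univ : Finset ℤˣ) = {1, -1} := rfl
  rw [this, Finset.sum_pair (by decide)]

/-- If the four spins split 4-0 or 2-2, a single rotated variable is nonzero, equal to `±4`, and the
global flip cancels odd powers. If one spin differs, all four are `±2`; the signs cancel unless all
exponents have the same parity, and then every term is positive. The sign chosen for the last row of
`replicaSign` is what makes the all-odd case positive. The proof checks the parities one by one. -/
lemma sum_prod_rotated_pow_nonneg (e : Fin 4 → ℕ) :
    0 ≤ ∑ s : Fin 4 → ℤˣ, ∏ k, rotated k s ^ e k := by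
  have h : ∀ p : ℤˣ × ℤˣ × ℤˣ × ℤˣ, ∏ k, rotated k (quadEquiv ℤˣ p) ^ e k
      = ((p.1 : ℤ) + (p.2.1 : ℤ) + (p.2.2.1 : ℤ) + (p.2.2.2 : ℤ) : ℝ) ^ e 0
        * ((p.1 : ℤ) + (p.2.1 : ℤ) - (p.2.2.1 : ℤ) - (p.2.2.2 : ℤ) : ℝ) ^ e 1
        * ((p.1 : ℤ) - (p.2.1 : ℤ) + (p.2.2.1 : ℤ) - (p.2.2.2 : ℤ) : ℝ) ^ e 2
        * (-(p.1 : ℤ) + (p.2.1 : ℤ) + (p.2.2.1 : ℤ) - (p.2.2.2 : ℤ) : ℝ) ^ e 3 := by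
    intro p
    simp [Fin.prod_univ_four, rotated, replicaSign, Fin.sum_univ_four, sub_eq_add_neg]
    rfl
  rw [← (quadEquiv ℤˣ).sum_comp]
  simp only [h, Fintype.sum_prod_type, sum_intUnits]
  generalize e 0 = a
  generalize e 1 = b
  generalize e 2 = c
  generalize e 3 = d
  norm_num
  rcases Nat.even_or_odd a with ha | ha <;> rcases Nat.even_or_odd b with hb | hb <;>
  rcases Nat.even_or_odd c with hc | hc <;> rcases Nat.even_or_odd d with hd | hd <;>
  simp only [ha.neg_pow, hb.neg_pow, hc.neg_pow, hd.neg_pow] <;> ring_nf <;> positivity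

/-- Functions of four replicas whose sums against all monomials in the rotated variables are
nonnegative. -/
def ReplicaPositive {n : ℕ} (f : (Fin n → Fin 4 → ℤˣ) → ℝ) : Prop :=
  ∀ e : Fin n → Fin 4 → ℕ, 0 ≤ ∑ v, f v * ∏ i, ∏ k, rotated k (v i) ^ e i k

/-- Functions that preserve `ReplicaPositive` by multiplication. -/
def ReplicaMultiplier {n : ℕ} (g : (Fin n → Fin 4 → ℤˣ) → ℝ) : Prop :=
  ∀ f, ReplicaPositive f → ReplicaPositive (g * f)

variable {n : ℕ}

/-- Without interaction the sum factorizes over sites, leaving the single-site inequality. -/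
lemma replicaPositive_one : ReplicaPositive (n := n) 1 := by
  intro e
  simp only [Pi.one_apply, one_mul]
  rw [← Fintype.prod_sum fun i (s : Fin 4 → ℤˣ) => ∏ k, rotated k s ^ e i k]
  exact Finset.prod_nonneg fun i _ => sum_prod_rotated_pow_nonneg (e i)

lemma replicaMultiplier_rotated (k : Fin 4) (i : Fin n) :
    ReplicaMultiplier (fun v => rotated k (v i)) := by
  intro f hf e
  convert hf (e + Pi.single i (Pi.single k 1)) using 2 with v
  have h : ∏ j, ∏ l, rotated l (v j) ^ (Pi.single i (Pi.single k 1) : Fin n → Fin 4 → ℕ) j l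
      = rotated k (v i) := by
    rw [Finset.prod_eq_single i, Finset.prod_eq_single k]
    · simp
    · intro l _ hl; simp [Pi.single_eq_of_ne hl]
    · simp
    · intro j _ hj; simp [Pi.single_eq_of_ne hj]
    · simp
  simp only [Pi.add_apply, pow_add, Finset.prod_mul_distrib, h, Pi.mul_apply]
  ring

lemma ReplicaMultiplier.add {g h : (Fin n → Fin 4 → ℤˣ) → ℝ} (hg : ReplicaMultiplier g)
    (hh : ReplicaMultiplier h) : ReplicaMultiplier (g + h) := by
  intro f hf e
  simpa only [Pi.mul_apply, Pi.add_apply, add_mul, Finset.sum_add_distrib]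
    using add_nonneg (hg f hf e) (hh f hf e)

lemma ReplicaMultiplier.mul {g h : (Fin n → Fin 4 → ℤˣ) → ℝ} (hg : ReplicaMultiplier g)
    (hh : ReplicaMultiplier h) : ReplicaMultiplier (g * h) := by
  intro f hf
  rw [mul_assoc]
  exact hg _ (hh f hf)

lemma ReplicaMultiplier.const_mul {g : (Fin n → Fin 4 → ℤˣ) → ℝ} (hg : ReplicaMultiplier g)
    {c : ℝ} (hc : 0 ≤ c) : ReplicaMultiplier (fun v => c * g v) := by
  intro f hf e
  simpa only [Pi.mul_apply, mul_assoc, ← Finset.mul_sum] using mul_nonneg hc (hg f hf e)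

lemma replicaMultiplier_one : ReplicaMultiplier (n := n) 1 := fun f hf => by rwa [one_mul]

lemma replicaMultiplier_sum {ι : Type*} (s : Finset ι) {g : ι → (Fin n → Fin 4 → ℤˣ) → ℝ}
    (hg : ∀ i ∈ s, ReplicaMultiplier (g i)) : ReplicaMultiplier (fun v => ∑ i ∈ s, g i v) := by
  have h : ReplicaMultiplier (∑ i ∈ s, g i) := by
    refine Finset.sum_induction _ _ (fun _ _ => ReplicaMultiplier.add) ?_ hg
    intro f _ e
    simp
  convert h using 1
  funext v
  simp

lemma ReplicaMultiplier.pow {g : (Fin n → Fin 4 → ℤˣ) → ℝ} (hg : ReplicaMultiplier g) (m : ℕ) :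
    ReplicaMultiplier (g ^ m) := by
  induction m with
  | zero => simpa using replicaMultiplier_one
  | succ m ih => rw [pow_succ]; exact ih.mul hg

/-- Multipliers are closed under sums, products and nonnegative scaling, so each `(1 + g / m) ^ m`
is one; let `m → ∞`. -/
lemma ReplicaMultiplier.exp {g : (Fin n → Fin 4 → ℤˣ) → ℝ} (hg : ReplicaMultiplier g) :
    ReplicaMultiplier (fun v => Real.exp (g v)) := by
  intro f hf e
  have hm : ∀ m : ℕ, ReplicaMultiplier ((1 + fun v => ((m : ℝ)⁻¹) * g v) ^ m) := fun m =>
    (replicaMultiplier_one.add (hg.const_mul (by positivity))).pow m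
  have hlim : Tendsto (fun m : ℕ => ∑ v, (((1 + fun v => ((m : ℝ)⁻¹) * g v) ^ m) * f) v
      * ∏ i, ∏ k, rotated k (v i) ^ e i k) atTop
      (𝓝 (∑ v, ((fun v => Real.exp (g v)) * f) v * ∏ i, ∏ k, rotated k (v i) ^ e i k)) := by
    refine tendsto_finsetSum _ fun v _ => (Tendsto.mul_const _ ?_).mul_const _
    simpa [div_eq_inv_mul] using Real.tendsto_one_add_div_pow_exp (g v)
  exact ge_of_tendsto' hlim fun m => hm m f hf e

/-- The signed four-replica sum computes the third cumulant. -/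
lemma sum_replica_eq {X : Type*} [Fintype X] (W F G K : X → ℝ) :
    ∑ v : Fin 4 → X, (∏ a, W (v a)) * ((∑ a, replicaSign 1 a * F (v a))
        * (∑ a, replicaSign 2 a * G (v a)) * (∑ a, replicaSign 3 a * K (v a)))
      = -4 * ((∑ x, W x) ^ 3 * (∑ x, W x * (F x * G x * K x))
        - (∑ x, W x) ^ 2 * ((∑ x, W x * (F x * G x)) * (∑ x, W x * K x)
          + (∑ x, W x * (F x * K x)) * (∑ x, W x * G x)
          + (∑ x, W x * (G x * K x)) * (∑ x, W x * F x))
        + 2 * (∑ x, W x) * ((∑ x, W x * F x) * (∑ x, W x * G x) * (∑ x, W x * K x))) := by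
  -- The flags record which of `F`, `G`, `K` are evaluated at a given replica. Replicas are
  -- independent, so every term of the expansion is a product of four such moments.
  obtain ⟨M, hM⟩ : ∃ M : Bool → Bool → Bool → ℝ, ∀ p q r, M p q r = ∑ x, W x
      * ((if p then F x else 1) * (if q then G x else 1) * (if r then K x else 1)) :=
    ⟨_, fun _ _ _ => rfl⟩
  have key : ∀ a b c : Fin 4, ∑ v : Fin 4 → X, (∏ d, W (v d)) * (F (v a) * G (v b) * K (v c))
      = ∏ d, M (decide (d = a)) (decide (d = b)) (decide (d = c)) := by
    intro a b c
    simp only [hM]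
    rw [Fintype.prod_sum]
    refine Finset.sum_congr rfl fun v _ => ?_
    simp only [decide_eq_true_eq, Finset.prod_mul_distrib, Finset.prod_ite_eq', Finset.mem_univ, if_true]
  have expand : ∀ v : Fin 4 → X, (∏ a, W (v a)) * ((∑ a, replicaSign 1 a * F (v a))
        * (∑ a, replicaSign 2 a * G (v a)) * (∑ a, replicaSign 3 a * K (v a)))
      = ∑ a, ∑ b, ∑ c, replicaSign 1 a * replicaSign 2 b * replicaSign 3 c
        * ((∏ d, W (v d)) * (F (v a) * G (v b) * K (v c))) := by
    intro v
    rw [Finset.sum_mul_sum, Finset.sum_mul, Finset.mul_sum]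
    refine Finset.sum_congr rfl fun a _ => ?_
    rw [Finset.sum_mul_sum, Finset.mul_sum]
    refine Finset.sum_congr rfl fun b _ => ?_
    rw [Finset.mul_sum]
    refine Finset.sum_congr rfl fun c _ => ?_
    ring
  have total : ∑ v : Fin 4 → X, (∏ a, W (v a)) * ((∑ a, replicaSign 1 a * F (v a))
        * (∑ a, replicaSign 2 a * G (v a)) * (∑ a, replicaSign 3 a * K (v a)))
      = ∑ a, ∑ b, ∑ c, replicaSign 1 a * replicaSign 2 b * replicaSign 3 c
        * ∏ d, M (decide (d = a)) (decide (d = b)) (decide (d = c)) := by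
    rw [Finset.sum_congr rfl fun v _ => expand v, Finset.sum_comm]
    refine Finset.sum_congr rfl fun a _ => ?_
    rw [Finset.sum_comm]
    refine Finset.sum_congr rfl fun b _ => ?_
    rw [Finset.sum_comm]
    refine Finset.sum_congr rfl fun c _ => ?_
    rw [← Finset.mul_sum, key]
  have e0 : ∑ x, W x = M false false false := by simp [hM]
  have e1 : ∑ x, W x * F x = M true false false := by simp [hM]
  have e2 : ∑ x, W x * G x = M false true false := by simp [hM]
  have e3 : ∑ x, W x * K x = M false false true := by simp [hM]
  have e12 : ∑ x, W x * (F x * G x) = M true true false := by simp [hM]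
  have e13 : ∑ x, W x * (F x * K x) = M true false true := by simp [hM]
  have e23 : ∑ x, W x * (G x * K x) = M false true true := by simp [hM]
  have e123 : ∑ x, W x * (F x * G x * K x) = M true true true := by simp [hM]
  rw [total, e0, e1, e2, e3, e12, e13, e23, e123]
  simp [Fin.sum_univ_four, Fin.prod_univ_four, replicaSign]
  ring

end Replica

/-- The GHS inequality: third cumulants of nonnegative linear forms are nonpositive. -/
lemma wcum3_weight_nonpos {n : ℕ} {β : ℝ} {Q : Matrix (Fin n) (Fin n) ℝ} {μ : Fin n → ℝ}
    (hJ : ∀ i j, 0 ≤ β * Q i j) (hμ : 0 ≤ μ) {p q r : Fin n → ℝ} (hp : 0 ≤ p) (hq : 0 ≤ q)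
    (hr : 0 ≤ r) :
    wcum3 (weight β Q μ) (fun x => p ⬝ᵥ spinVec x) (fun x => q ⬝ᵥ spinVec x)
      (fun x => r ⬝ᵥ spinVec x) ≤ 0 := by
  have hlin : ∀ (k : Fin 4) (c : Fin n → ℝ) (v : Fin n → Fin 4 → ℤˣ),
      ∑ a, replicaSign k a * (c ⬝ᵥ spinVec (fun i => v i a)) = ∑ i, c i * rotated k (v i) := by
    intro k c v
    simp only [dotProduct, rotated, Finset.mul_sum, spinVec]
    rw [Finset.sum_comm]
    exact Finset.sum_congr rfl fun i _ => Finset.sum_congr rfl fun a _ => by ring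
  have hmul : ∀ (k : Fin 4) {c : Fin n → ℝ}, 0 ≤ c →
      ReplicaMultiplier (fun v : Fin n → Fin 4 → ℤˣ => ∑ i, c i * rotated k (v i)) :=
    fun k c hc => replicaMultiplier_sum _ fun i _ => (replicaMultiplier_rotated k i).const_mul (hc i)
  -- The coefficient `1 / 8` is the `1 / 2` of the Hamiltonian over the squared norm `4`. The field
  -- meets only row `0`, whose entries are all `1`.
  have hH : ∀ v : Fin n → Fin 4 → ℤˣ, ∏ a, weight β Q μ (fun i => v i a)
      = Real.exp ((∑ i, ∑ j, (β * Q i j / 8) * ∑ k, rotated k (v i) * rotated k (v j))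
        + ∑ i, μ i * rotated 0 (v i)) := by
    intro v
    simp only [weight]
    rw [← Real.exp_sum, Finset.sum_add_distrib, ← hlin]
    congr 2
    · simp only [sum_rotated_mul_rotated, dotProduct, Matrix.mulVec, Finset.mul_sum, spinVec]
      rw [Finset.sum_comm]
      refine Finset.sum_congr rfl fun i _ => ?_
      rw [Finset.sum_comm]
      refine Finset.sum_congr rfl fun j _ => Finset.sum_congr rfl fun a _ => ?_
      ring
    · simp [replicaSign, Fin.sum_univ_four]
  have hexp : ReplicaMultiplier (fun v : Fin n → Fin 4 → ℤˣ =>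
      ∏ a, weight β Q μ (fun i => v i a)) := by
    simp only [hH]
    refine ReplicaMultiplier.exp (ReplicaMultiplier.add ?_ (hmul 0 hμ))
    refine replicaMultiplier_sum _ fun i _ => replicaMultiplier_sum _ fun j _ =>
      ReplicaMultiplier.const_mul (replicaMultiplier_sum _ fun k _ => ?_)
        (div_nonneg (hJ i j) (by norm_num))
    exact (replicaMultiplier_rotated k i).mul (replicaMultiplier_rotated k j)
  -- This sum is nonnegative, and by `sum_replica_eq` it equals `-4 * Z ^ 4` times the third
  -- cumulant.
  have hpos := (hexp.mul (((hmul 1 hp).mul (hmul 2 hq)).mul (hmul 3 hr))) 1 replicaPositive_one 0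
  simp only [mul_one, Pi.mul_apply, Pi.one_apply, Pi.zero_apply, pow_zero, Finset.prod_const_one,
    ← hlin] at hpos
  have hre := (Equiv.piComm (fun (_ : Fin n) (_ : Fin 4) => ℤˣ)).sum_comp
    fun v : Fin 4 → Spins n => (∏ a, weight β Q μ (v a))
      * ((∑ a, replicaSign 1 a * (p ⬝ᵥ spinVec (v a)))
        * (∑ a, replicaSign 2 a * (q ⬝ᵥ spinVec (v a)))
        * (∑ a, replicaSign 3 a * (r ⬝ᵥ spinVec (v a))))
  rw [sum_replica_eq (weight β Q μ) (fun x => p ⬝ᵥ spinVec x) (fun x => q ⬝ᵥ spinVec x)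
      (fun x => r ⬝ᵥ spinVec x)] at hre
  have hfin := hpos.trans_eq hre
  have hZ : 0 < ∑ x, weight β Q μ x :=
    Finset.sum_pos (fun x _ => Real.exp_pos _) Finset.univ_nonempty
  simp only [wcum3, wmean, Pi.mul_apply]
  set Z := ∑ x, weight β Q μ x
  rw [show ∀ a b c d e f g : ℝ, a / Z - b / Z * (c / Z) - d / Z * (e / Z) - f / Z * (g / Z)
      + 2 * (g / Z * (e / Z) * (c / Z)) = (Z ^ 3 * a - Z ^ 2 * (b * c + d * e + f * g)
        + 2 * Z * (g * e * c)) / Z ^ 4 by intros; field_simp; ring]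
  exact div_nonpos_of_nonpos_of_nonneg (by linarith) (by positivity)

/-! ### Ising measures as exponential families; monotonicity in the field -/

section IsingBasics

variable {n : ℕ} {β : ℝ} {Q : Matrix (Fin n) (Fin n) ℝ}

lemma weight_pos (β : ℝ) (Q : Matrix (Fin n) (Fin n) ℝ) (μ : Fin n → ℝ) (x : Spins n) :
    0 < weight β Q μ x := Real.exp_pos _

lemma weight_nonneg (β : ℝ) (Q : Matrix (Fin n) (Fin n) ℝ) (μ : Fin n → ℝ) :
    0 ≤ weight β Q μ := fun x => (weight_pos β Q μ x).le

lemma sum_weight_pos (β : ℝ) (Q : Matrix (Fin n) (Fin n) ℝ) (μ : Fin n → ℝ) :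
    0 < ∑ x, weight β Q μ x :=
  Finset.sum_pos (fun x _ => weight_pos β Q μ x) Finset.univ_nonempty

lemma expect_eq_wmean (β : ℝ) (Q : Matrix (Fin n) (Fin n) ℝ) (μ : Fin n → ℝ)
    (f : Spins n → ℝ) : expect β Q μ f = wmean (weight β Q μ) f := by
  simp only [expect, wmean, partitionFn, Finset.sum_div, div_mul_eq_mul_div]

lemma cov_eq_wcov (β : ℝ) (Q : Matrix (Fin n) (Fin n) ℝ) (μ : Fin n → ℝ)
    (f g : Spins n → ℝ) : cov β Q μ f g = wcov (weight β Q μ) f g := by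
  simp only [cov, expect_eq_wmean]
  exact wmean_centered (sum_weight_pos β Q μ).ne' f g

lemma wmean_indicator_mul {X : Type*} [Fintype X] {w : X → ℝ} (Ω : Set X) (f : X → ℝ)
    (hΩ : ∑ x, Ω.indicator w x ≠ 0) :
    wmean w (Ω.indicator 1) * wmean (Ω.indicator w) f = wmean w (Ω.indicator f) := by
  have h1 : ∀ x, w x * Ω.indicator (1 : X → ℝ) x = Ω.indicator w x := fun x => by
    by_cases hx : x ∈ Ω <;> simp [hx]
  have h2 : ∀ x, w x * Ω.indicator f x = Ω.indicator w x * f x := fun x => by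
    by_cases hx : x ∈ Ω <;> simp [hx]
  simp only [wmean, h1, h2]
  field_simp

lemma sum_indicator_weight_pos (β : ℝ) (Q : Matrix (Fin n) (Fin n) ℝ) (μ : Fin n → ℝ)
    {Ω : Set (Spins n)} (hΩ : Ω.Nonempty) : 0 < ∑ x, Ω.indicator (weight β Q μ) x := by
  obtain ⟨x, hx⟩ := hΩ
  refine Finset.sum_pos' (fun y _ => Set.indicator_nonneg (fun z _ => (weight_pos β Q μ z).le) y)
    ⟨x, Finset.mem_univ _, ?_⟩
  rw [Set.indicator_of_mem hx]
  exact weight_pos β Q μ x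

lemma prob_pos (β : ℝ) (Q : Matrix (Fin n) (Fin n) ℝ) (μ : Fin n → ℝ)
    {Ω : Set (Spins n)} (hΩ : Ω.Nonempty) : 0 < prob β Q μ Ω := by
  rw [prob, expect_eq_wmean]
  refine div_pos ?_ (sum_weight_pos β Q μ)
  have h : ∀ x, weight β Q μ x * Ω.indicator (1 : Spins n → ℝ) x
      = Ω.indicator (weight β Q μ) x := fun x => by
    by_cases hx : x ∈ Ω <;> simp [hx]
  simpa only [h] using sum_indicator_weight_pos β Q μ hΩ

lemma prob_nonneg (β : ℝ) (Q : Matrix (Fin n) (Fin n) ℝ) (μ : Fin n → ℝ)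
    (E : Set (Spins n)) : 0 ≤ prob β Q μ E := by
  rw [prob, expect_eq_wmean]
  exact wmean_nonneg (weight_nonneg β Q μ) fun x => Set.indicator_nonneg (fun _ _ => zero_le_one) x

lemma prob_add_prob_compl (β : ℝ) (Q : Matrix (Fin n) (Fin n) ℝ) (μ : Fin n → ℝ)
    (E : Set (Spins n)) : prob β Q μ Eᶜ + prob β Q μ E = 1 := by
  simp only [prob, expect_eq_wmean]
  rw [← wmean_add, add_comm, Set.indicator_self_add_compl]
  exact wmean_const (sum_weight_pos β Q μ).ne' 1

lemma prob_le_one (β : ℝ) (Q : Matrix (Fin n) (Fin n) ℝ) (μ : Fin n → ℝ)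
    (E : Set (Spins n)) : prob β Q μ E ≤ 1 := by
  linarith [prob_add_prob_compl β Q μ E, prob_nonneg β Q μ Eᶜ]

lemma condExpect_eq_wmean (β : ℝ) (Q : Matrix (Fin n) (Fin n) ℝ) (μ : Fin n → ℝ)
    {Ω : Set (Spins n)} (hΩ : Ω.Nonempty) (f : Spins n → ℝ) :
    condExpect β Q μ Ω f = wmean (Ω.indicator (weight β Q μ)) f := by
  have h := prob_pos β Q μ hΩ
  rw [condExpect, div_eq_iff h.ne', prob, expect_eq_wmean, expect_eq_wmean,
    ← wmean_indicator_mul Ω f (sum_indicator_weight_pos β Q μ hΩ).ne', mul_comm]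

lemma condVar_eq_wcov (β : ℝ) (Q : Matrix (Fin n) (Fin n) ℝ) (μ : Fin n → ℝ)
    {Ω : Set (Spins n)} (hΩ : Ω.Nonempty) (f : Spins n → ℝ) :
    condVar β Q μ Ω f = wcov (Ω.indicator (weight β Q μ)) f f := by
  simp only [condVar, condExpect_eq_wmean β Q μ hΩ, sq]
  exact wmean_centered (sum_indicator_weight_pos β Q μ hΩ).ne' f f

lemma condVar_univ (β : ℝ) (Q : Matrix (Fin n) (Fin n) ℝ) (μ : Fin n → ℝ) (f : Spins n → ℝ) :
    condVar β Q μ Set.univ f = var β Q μ f := by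
  rw [condVar_eq_wcov β Q μ Set.univ_nonempty, Set.indicator_univ, var, cov_eq_wcov]

lemma weight_add_smul (β : ℝ) (Q : Matrix (Fin n) (Fin n) ℝ) (μ ν : Fin n → ℝ) (t : ℝ) :
    weight β Q (μ + t • ν) = tilt (weight β Q μ) (fun x => ν ⬝ᵥ spinVec x) t := by
  funext x
  simp only [weight, tilt, add_dotProduct, smul_dotProduct, smul_eq_mul, ← Real.exp_add]
  ring_nf

lemma blockField_eq_smul (S : Finset (Fin n)) (t : ℝ) :
    blockField S t = t • blockField S 1 := by
  funext i; simp [blockField]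

lemma blockSum_eq_dotProduct (S : Finset (Fin n)) :
    blockSum S = fun x => blockField S 1 ⬝ᵥ spinVec x := by
  funext x; simp [blockSum, blockField, dotProduct]

lemma blockField_nonneg (S : Finset (Fin n)) {t : ℝ} (ht : 0 ≤ t) : 0 ≤ blockField S t := by
  intro i; simp only [blockField]; split_ifs <;> simp [ht]

lemma weight_blockField (β : ℝ) (Q : Matrix (Fin n) (Fin n) ℝ) (S : Finset (Fin n)) (t : ℝ) :
    weight β Q (blockField S t) = tilt (weight β Q 0) (blockSum S) t := by
  rw [blockSum_eq_dotProduct, ← weight_add_smul, zero_add, ← blockField_eq_smul]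

lemma indicator_tilt {X : Type*} (w φ : X → ℝ) (t : ℝ) (Ω : Set X) :
    Ω.indicator (tilt w φ t) = tilt (Ω.indicator w) φ t := by
  funext x
  by_cases hx : x ∈ Ω <;> simp [tilt, hx]

lemma blockSum_union {S₁ S₂ : Finset (Fin n)} (h : Disjoint S₁ S₂) :
    blockSum (S₁ ∪ S₂) = blockSum S₁ + blockSum S₂ := by
  funext x; simp [blockSum, Finset.sum_union h]

lemma blockField_union {S₁ S₂ : Finset (Fin n)} (h : Disjoint S₁ S₂) (t : ℝ) :
    blockField (S₁ ∪ S₂) t = blockField S₁ t + blockField S₂ t := by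
  funext i
  have : i ∈ S₁ → i ∉ S₂ := fun hi => Finset.disjoint_left.1 h hi
  by_cases h1 : i ∈ S₁ <;> by_cases h2 : i ∈ S₂ <;> simp_all [blockField]

lemma supp_blockField (S : Finset (Fin n)) {t : ℝ} (ht : t ≠ 0) : supp (blockField S t) = S := by
  ext i; simp [supp, blockField, ht]

/-- Covariances of nonnegative linear forms decrease as a nonnegative field increases. -/
lemma cov_add_field_le (hJ : ∀ i j, 0 ≤ β * Q i j) {μ ν p q : Fin n → ℝ} (hμ : 0 ≤ μ)
    (hν : 0 ≤ ν) (hp : 0 ≤ p) (hq : 0 ≤ q) :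
    cov β Q (μ + ν) (fun x => p ⬝ᵥ spinVec x) (fun x => q ⬝ᵥ spinVec x)
      ≤ cov β Q μ (fun x => p ⬝ᵥ spinVec x) (fun x => q ⬝ᵥ spinVec x) := by
  have hd := hasDerivAt_wcov_tilt (weight_nonneg β Q μ) (sum_weight_pos β Q μ)
    (fun x => ν ⬝ᵥ spinVec x) (fun x => p ⬝ᵥ spinVec x) (fun x => q ⬝ᵥ spinVec x)
  have hanti : AntitoneOn (fun t => wcov (tilt (weight β Q μ) (fun x => ν ⬝ᵥ spinVec x) t)
      (fun x => p ⬝ᵥ spinVec x) (fun x => q ⬝ᵥ spinVec x)) (Set.Icc 0 1) := by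
    refine antitoneOn_of_deriv_nonpos (convex_Icc 0 1)
      (fun t _ => (hd t).continuousAt.continuousWithinAt)
      (fun t _ => (hd t).differentiableAt.differentiableWithinAt) fun t ht => ?_
    rw [(hd t).deriv, ← weight_add_smul]
    have ht0 : 0 ≤ t := (interior_subset ht).1
    exact wcum3_weight_nonpos hJ (add_nonneg hμ (smul_nonneg ht0 hν)) hp hq hν
  have h := hanti (Set.left_mem_Icc.2 zero_le_one) (Set.right_mem_Icc.2 zero_le_one) zero_le_one
  simp only [← weight_add_smul, one_smul, zero_smul, add_zero] at h
  rwa [cov_eq_wcov, cov_eq_wcov]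

lemma cov_blockSum_add_field_le (hJ : ∀ i j, 0 ≤ β * Q i j) {μ ν : Fin n → ℝ} (hμ : 0 ≤ μ)
    (hν : 0 ≤ ν) (S₁ S₂ : Finset (Fin n)) :
    cov β Q (μ + ν) (blockSum S₁) (blockSum S₂) ≤ cov β Q μ (blockSum S₁) (blockSum S₂) := by
  rw [blockSum_eq_dotProduct, blockSum_eq_dotProduct]
  exact cov_add_field_le hJ hμ hν (blockField_nonneg S₁ zero_le_one)
    (blockField_nonneg S₂ zero_le_one)

lemma var_blockSum_le (hJ : ∀ i j, 0 ≤ β * Q i j) (S : Finset (Fin n)) {η : ℝ} (hη : 0 ≤ η) :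
    var β Q (blockField S η) (blockSum S) ≤ var β Q 0 (blockSum S) := by
  have h := cov_blockSum_add_field_le hJ le_rfl (blockField_nonneg S hη) S S
  rwa [zero_add] at h

/-- Split the variance of the union as `Var + Var + 2 Cov`. By GHS each block variance is at most
its value under its own field, so it is absorbed, and the covariance is at most its value at zero
field. -/
lemma var_blockSum_union_sub_le (hJ : ∀ i j, 0 ≤ β * Q i j) {S₁ S₂ : Finset (Fin n)}
    (h : Disjoint S₁ S₂) {η : ℝ} (hη : 0 ≤ η) :
    var β Q (blockField (S₁ ∪ S₂) η) (blockSum (S₁ ∪ S₂))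
      - var β Q (blockField S₁ η) (blockSum S₁) - var β Q (blockField S₂ η) (blockSum S₂)
      ≤ 2 * cov β Q 0 (blockSum S₁) (blockSum S₂) := by
  have n1 := blockField_nonneg S₁ hη
  have n2 := blockField_nonneg S₂ hη
  have h1 := cov_blockSum_add_field_le hJ n1 n2 S₁ S₁
  have h2 := cov_blockSum_add_field_le hJ n2 n1 S₂ S₂
  have h3 := cov_blockSum_add_field_le hJ le_rfl (add_nonneg n1 n2) S₁ S₂
  rw [add_comm] at h2
  rw [zero_add] at h3
  rw [blockField_union h, blockSum_union h]
  simp only [var]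
  rw [cov_eq_wcov _ _ _ (_ + _), wcov_add_self, ← cov_eq_wcov, ← cov_eq_wcov, ← cov_eq_wcov]
  linarith

lemma spinVec_mono {x y : Spins n} (h : x ≤ y) (i : Fin n) : spinVec x i ≤ spinVec y i := by
  have : ((x i : ℤˣ) : ℤ) ≤ (y i : ℤ) := h i
  simp only [spinVec]
  exact_mod_cast this

lemma spinVec_mul_add_le (x y : Spins n) (i j : Fin n) :
    spinVec x i * spinVec x j + spinVec y i * spinVec y j
      ≤ spinVec (x ⊓ y) i * spinVec (x ⊓ y) j + spinVec (x ⊔ y) i * spinVec (x ⊔ y) j := by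
  have key : ∀ a b c d : ℤˣ, (a * b + c * d : ℤ)
      ≤ ((a ⊓ c : ℤˣ) : ℤ) * ((b ⊓ d : ℤˣ) : ℤ) + ((a ⊔ c : ℤˣ) : ℤ) * ((b ⊔ d : ℤˣ) : ℤ) := by
    decide
  have := key (x i) (x j) (y i) (y j)
  simp only [spinVec, Pi.inf_apply, Pi.sup_apply]
  exact_mod_cast this

/-- The FKG lattice condition, which holds pair by pair because couplings are nonnegative. -/
lemma weight_mul_weight_le (hJ : ∀ i j, 0 ≤ β * Q i j) (x y : Spins n) :
    weight β Q 0 x * weight β Q 0 y ≤ weight β Q 0 (x ⊓ y) * weight β Q 0 (x ⊔ y) := by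
  have hq : ∀ z : Spins n, β / 2 * (spinVec z ⬝ᵥ Q.mulVec (spinVec z))
      = ∑ i, ∑ j, β * Q i j / 2 * (spinVec z i * spinVec z j) := by
    intro z
    simp only [dotProduct, Matrix.mulVec, Finset.mul_sum]
    exact Finset.sum_congr rfl fun i _ => Finset.sum_congr rfl fun j _ => by ring
  simp only [weight, zero_dotProduct, add_zero, ← Real.exp_add, hq, ← Finset.sum_add_distrib,
    ← mul_add]
  exact Real.exp_le_exp.2 (Finset.sum_le_sum fun i _ => Finset.sum_le_sum fun j _ =>
    mul_le_mul_of_nonneg_left (spinVec_mul_add_le x y i j) (div_nonneg (hJ i j) zero_le_two))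

/-- Increasing events become more likely under a nonnegative block field. -/
lemma prob_zero_le_prob_blockField (hJ : ∀ i j, 0 ≤ β * Q i j) {Ω : Set (Spins n)}
    (hΩ : IsUpperSet Ω) (S : Finset (Fin n)) {a : ℝ} (ha : 0 ≤ a) :
    prob β Q 0 Ω ≤ prob β Q (blockField S a) Ω := by
  have h := fkg (μ := weight β Q 0) (f := Ω.indicator 1)
    (g := fun x => Real.exp (a * blockSum S x))
    (weight_nonneg β Q 0) (fun x => Set.indicator_nonneg (fun _ _ => zero_le_one) x)
    (fun x => (Real.exp_pos _).le) (fun x y hxy => by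
      by_cases hx : x ∈ Ω
      · simp [hx, hΩ hxy hx]
      · rw [Set.indicator_of_notMem hx]
        exact Set.indicator_nonneg (fun _ _ => zero_le_one) y)
    (fun x y hxy => by
      refine Real.exp_le_exp.2 (mul_le_mul_of_nonneg_left ?_ ha)
      exact Finset.sum_le_sum fun i _ => spinVec_mono hxy i)
    (weight_mul_weight_le hJ)
  simp only [prob, expect_eq_wmean]
  have p0 := sum_weight_pos β Q 0
  have p1 := sum_weight_pos β Q (blockField S a)
  rw [wmean, wmean, div_le_div_iff₀ p0 p1]
  rw [weight_blockField]
  simp only [tilt]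
  calc _ ≤ _ := h
    _ = _ := by
      rw [mul_comm]
      congr 1
      exact Finset.sum_congr rfl fun x _ => by ring

end IsingBasics

/-! ### Lower bounds on the risk at fixed `n` -/

section RiskBounds

variable {n : ℕ} {β : ℝ} {Q : Matrix (Fin n) (Fin n) ℝ} {𝒞 𝒞' : Finset (Finset (Fin n))} {A : ℝ}

lemma bddAbove_typeII (β : ℝ) (Q : Matrix (Fin n) (Fin n) ℝ) (𝒞 : Finset (Finset (Fin n)))
    (A : ℝ) (E : Set (Spins n)) :
    BddAbove (Set.range fun μ : alternatives 𝒞 A => prob β Q (μ : Fin n → ℝ) E) :=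
  ⟨1, by rintro _ ⟨μ, rfl⟩; exact prob_le_one β Q μ E⟩

lemma risk_nonneg (T : Test n) : 0 ≤ risk β Q 𝒞 A T :=
  add_nonneg (prob_nonneg _ _ _ _) (Real.iSup_nonneg fun _ => prob_nonneg _ _ _ _)

lemma risk_le_two (T : Test n) : risk β Q 𝒞 A T ≤ 2 := by
  have h : ⨆ μ : alternatives 𝒞 A, prob β Q (μ : Fin n → ℝ) {x | T x = 0} ≤ 1 :=
    Real.iSup_le (fun μ => prob_le_one _ _ _ _) zero_le_one
  have := prob_le_one β Q 0 {x | T x = 1}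
  simp only [risk]
  linarith

lemma risk_always_reject_le : risk β Q 𝒞 A (fun _ => 1) ≤ 1 := by
  have h : ⨆ μ : alternatives 𝒞 A, prob β Q (μ : Fin n → ℝ) {_x | (1 : Fin 2) = 0} ≤ 0 := by
    refine Real.iSup_le (fun μ => ?_) le_rfl
    simp [prob, expect]
  have := prob_le_one β Q 0 {_x | (1 : Fin 2) = 1}
  exact (add_le_add this h).trans_eq (add_zero 1)

lemma setOf_test_eq_one (T : Test n) : {x | T x = 1} = {x | T x = 0}ᶜ := by
  ext x
  simp only [Set.mem_ofPred_eq, Set.mem_compl_iff]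
  generalize T x = b
  fin_cases b <;> simp

lemma blockField_mem_alternatives {S : Finset (Fin n)} (hS : S ∈ 𝒞) {t : ℝ} (ht : 0 < t)
    (hA : A ≤ t) : blockField S t ∈ alternatives 𝒞 A := by
  refine ⟨blockField_nonneg S ht.le, by rwa [supp_blockField S ht.ne'], fun i hi => ?_⟩
  rw [supp_blockField S ht.ne'] at hi
  simpa [blockField, hi] using hA

lemma prob_add_prob_blockField_le_risk {S : Finset (Fin n)} (hS : S ∈ 𝒞) {t : ℝ} (ht : 0 < t)
    (hA : A ≤ t) (T : Test n) :
    prob β Q 0 {x | T x = 0}ᶜ + prob β Q (blockField S t) {x | T x = 0} ≤ risk β Q 𝒞 A T := by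
  rw [risk, setOf_test_eq_one]
  gcongr
  exact le_ciSup (bddAbove_typeII β Q 𝒞 A {x | T x = 0})
    ⟨blockField S t, blockField_mem_alternatives hS ht hA⟩

/-- When the signal may be arbitrarily small, no test beats a trivial one. -/
lemma one_le_risk_of_nonpos (hne : 𝒞.Nonempty) (hA : A ≤ 0) (T : Test n) :
    1 ≤ risk β Q 𝒞 A T := by
  obtain ⟨S, hS⟩ := hne
  set E := {x | T x = 0} with hE
  have hc : Tendsto (fun t => prob β Q 0 Eᶜ + prob β Q (blockField S t) E) (𝓝[>] 0)
      (𝓝 (prob β Q 0 Eᶜ + prob β Q 0 E)) := by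
    refine Tendsto.const_add _ (Tendsto.mono_left ?_ nhdsWithin_le_nhds)
    have h := (hasDerivAt_wmean_tilt (weight_nonneg β Q 0) (sum_weight_pos β Q 0)
      (blockSum S) (E.indicator 1) 0).continuousAt.tendsto
    simpa only [prob, expect_eq_wmean, weight_blockField, tilt_zero] using h
  rw [prob_add_prob_compl] at hc
  refine le_of_tendsto hc ?_
  filter_upwards [self_mem_nhdsWithin] with t ht
  exact prob_add_prob_blockField_le_risk hS ht (hA.trans (le_of_lt ht)) T

lemma prob_mul_wmean_le_prob (β : ℝ) (Q : Matrix (Fin n) (Fin n) ℝ) (μ : Fin n → ℝ)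
    {Ω : Set (Spins n)} (hΩ : Ω.Nonempty) (E : Set (Spins n)) :
    prob β Q μ Ω * wmean (Ω.indicator (weight β Q μ)) (E.indicator 1) ≤ prob β Q μ E := by
  simp only [prob, expect_eq_wmean]
  rw [wmean_indicator_mul Ω _ (sum_indicator_weight_pos β Q μ hΩ).ne']
  unfold wmean
  gcongr with x
  · exact (sum_weight_pos β Q μ).le
  · exact (weight_pos β Q μ x).le
  · exact Set.indicator_le_self' (fun x _ => Set.indicator_nonneg (fun _ _ => zero_le_one) x) x

/-- Nonasymptotic lower bound on the risk, by the second moment method restricted to `Ω`. -/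
lemma prob_mul_one_sub_le_risk (hJ : ∀ i j, 0 ≤ β * Q i j) (hsub : 𝒞' ⊆ 𝒞)
    (hdisj : (𝒞' : Set (Finset (Fin n))).PairwiseDisjoint id) (hne : 𝒞'.Nonempty) (hA : 0 < A)
    {Ω : Set (Spins n)} (hup : IsUpperSet Ω) {r m : ℝ} (hm0 : 0 ≤ m)
    (hr : ∀ η ∈ Set.Icc 0 A, ∀ S ∈ 𝒞', condVar β Q (blockField S (2 * η)) Ω (blockSum S) ≤ r)
    (hm : ∀ η ∈ Set.Icc 0 A, ∀ S₁ ∈ 𝒞', ∀ S₂ ∈ 𝒞', S₁ ≠ S₂ →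
      condVar β Q (blockField (S₁ ∪ S₂) η) Ω (blockSum (S₁ ∪ S₂))
        - condVar β Q (blockField S₁ η) Ω (blockSum S₁)
        - condVar β Q (blockField S₂ η) Ω (blockSum S₂) ≤ m) (T : Test n) :
    prob β Q 0 Ω * (1 - √(Real.exp (2 * A ^ 2 * r) / 𝒞'.card + (Real.exp (m * A ^ 2 / 2) - 1)))
      ≤ risk β Q 𝒞 A T := by
  rcases Ω.eq_empty_or_nonempty with rfl | hΩ
  · simpa [prob, expect] using risk_nonneg T
  set E := {x | T x = 0} with hE
  set w := Ω.indicator (weight β Q 0) with hw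
  have hw0 : 0 ≤ w := Set.indicator_nonneg fun x _ => (weight_pos β Q 0 x).le
  have hws : 0 < ∑ x, w x := sum_indicator_weight_pos β Q 0 hΩ
  -- Restriction to `Ω` commutes with tilting, so the second moment method applies to `w` verbatim.
  have htilt : ∀ S t, Ω.indicator (weight β Q (blockField S t)) = tilt w (blockSum S) t :=
    fun S t => by rw [weight_blockField, indicator_tilt]
  simp only [condVar_eq_wcov _ _ _ hΩ, htilt] at hr hm
  have hmain := one_sub_le_error_sum 𝒞' hne hw0 hws blockSum A
    (D := Real.exp (2 * A ^ 2 * r)) (δ := Real.exp (m * A ^ 2 / 2) - 1)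
    (fun S hS => sum_tilt_double_le hw0 hws (blockSum S) hA.le fun t ht => hr t ht S hS)
    (by have := Real.one_le_exp (x := m * A ^ 2 / 2) (by positivity); linarith)
    (fun S₁ h₁ S₂ h₂ h => by
      rw [add_sub_cancel]
      refine sum_tilt_add_le hw0 hws (blockSum S₁) (blockSum S₂) hA.le fun t ht => ?_
      have := hm t ht S₁ h₁ S₂ h₂ h
      rwa [blockSum_union (show Disjoint S₁ S₂ from hdisj h₁ h₂ h)] at this) E
  have hN : (0 : ℝ) < 𝒞'.card := by exact_mod_cast hne.card_pos
  have h0 := prob_mul_wmean_le_prob β Q 0 hΩ Eᶜ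
  -- `P_S(E) ≥ P_S(Ω) P_S(E | Ω) ≥ P_0(Ω) P_S(E | Ω)`, the last step by FKG.
  have hS : ∀ S ∈ 𝒞', prob β Q 0 Ω * wmean (tilt w (blockSum S) A) (E.indicator 1)
      ≤ risk β Q 𝒞 A T - prob β Q 0 Eᶜ := by
    intro S hS
    have h1 := prob_mul_wmean_le_prob β Q (blockField S A) hΩ E
    rw [htilt] at h1
    have h2 := prob_add_prob_blockField_le_risk (β := β) (Q := Q) (hsub hS) hA le_rfl T
    have h3 := mul_le_mul_of_nonneg_right (prob_zero_le_prob_blockField hJ hup S hA.le)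
      (wmean_nonneg (tilt_nonneg hw0 (blockSum S) A)
        (f := E.indicator 1) fun x => Set.indicator_nonneg (fun _ _ => zero_le_one) x)
    linarith
  have hsum := Finset.sum_le_sum hS
  rw [← Finset.mul_sum, Finset.sum_const, nsmul_eq_mul] at hsum
  have havg : prob β Q 0 Ω * ((∑ S ∈ 𝒞', wmean (tilt w (blockSum S) A) (E.indicator 1))
      / 𝒞'.card) ≤ risk β Q 𝒞 A T - prob β Q 0 Eᶜ := by
    rw [mul_div_assoc', div_le_iff₀ hN]
    linarith
  have := mul_le_mul_of_nonneg_left hmain (prob_nonneg β Q 0 Ω)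
  rw [mul_add] at this
  linarith

end RiskBounds

/-! ### Choice of constants and passage to the limit -/

section Asymptotics

/-- From `2x ≤ exp (2x) - 1` one gets `x * (1 - tanh x) ≤ tanh x`. -/
lemma le_two_mul_tanh {x : ℝ} (hx : 0 ≤ x) (h : Real.tanh x ≤ 1 / 2) :
    x ≤ 2 * Real.tanh x := by
  have hc := Real.cosh_pos x
  have h1 : 2 * x * (Real.cosh x - Real.sinh x) ≤ Real.sinh x + Real.sinh x := by
    rw [Real.cosh_sub_sinh]
    have h2 : Real.sinh x + Real.sinh x = Real.exp (-x) * (Real.exp (2 * x) - 1) := by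
      rw [Real.sinh_eq, mul_sub, ← Real.exp_add]; ring_nf
    rw [h2, mul_comm]
    exact mul_le_mul_of_nonneg_left (by linarith [Real.add_one_le_exp (2 * x)])
      (Real.exp_pos _).le
  rw [Real.tanh_eq_sinh_div_cosh] at h ⊢
  rw [div_le_iff₀ hc] at h
  rw [mul_div_assoc', le_div_iff₀ hc]
  nlinarith

/-- The signal bound turns into bounds on the two exponents of the second moment. -/
lemma signal_exponents_le {Cl A r r' L : ℝ} (hCl : 0 < Cl) (hL : 0 < L) (hr : L ≤ r)
    (hr' : 0 < r') (hA : 0 < A)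
    (h : Real.tanh A ≤ min (1 / 2) (√Cl / 4) * min (√(L / r)) (√(1 / r'))) :
    2 * A ^ 2 * r ≤ Cl / 2 * L ∧ A ^ 2 * r' ≤ 1 := by
  set c := min (1 / 2) (√Cl / 4) with hc
  have hr0 : 0 < r := hL.trans_le hr
  have hc0 : 0 < c := lt_min (by norm_num) (by positivity)
  have hc1 : c ≤ 1 / 2 := min_le_left _ _
  have hc2 : c ^ 2 ≤ Cl / 16 := by
    have : c ≤ √Cl / 4 := min_le_right _ _
    calc c ^ 2 ≤ (√Cl / 4) ^ 2 := by gcongr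
      _ = Cl / 16 := by rw [div_pow, Real.sq_sqrt hCl.le]; norm_num
  have h1 : Real.tanh A ≤ c * √(L / r) := h.trans (by gcongr; exact min_le_left _ _)
  have h2 : Real.tanh A ≤ c * √(1 / r') := h.trans (by gcongr; exact min_le_right _ _)
  have hs : √(L / r) ≤ 1 := Real.sqrt_le_one.2 ((div_le_one hr0).2 hr)
  have hhalf : Real.tanh A ≤ 1 / 2 := by nlinarith
  have hA2 := le_two_mul_tanh hA.le hhalf
  have k1 : A ^ 2 ≤ 4 * c ^ 2 * (L / r) := by
    calc A ^ 2 ≤ (2 * (c * √(L / r))) ^ 2 := by gcongr; linarith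
      _ = 4 * c ^ 2 * (L / r) := by rw [mul_pow, mul_pow, Real.sq_sqrt (by positivity)]; ring
  have k2 : A ^ 2 ≤ 4 * c ^ 2 * (1 / r') := by
    calc A ^ 2 ≤ (2 * (c * √(1 / r'))) ^ 2 := by gcongr; linarith
      _ = 4 * c ^ 2 * (1 / r') := by rw [mul_pow, mul_pow, Real.sq_sqrt (by positivity)]; ring
  constructor
  · calc 2 * A ^ 2 * r ≤ 2 * (4 * c ^ 2 * (L / r)) * r := by gcongr
      _ = 8 * c ^ 2 * L := by field_simp; ring
      _ ≤ 8 * (Cl / 16) * L := by gcongr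
      _ = Cl / 2 * L := by ring
  · calc A ^ 2 * r' ≤ 4 * c ^ 2 * (1 / r') * r' := by gcongr
      _ = 4 * c ^ 2 := by field_simp
      _ ≤ 4 * (1 / 2) ^ 2 := by gcongr
      _ = 1 := by norm_num

/-- Under the conditions on the conditional variances, all risks are eventually at least
`(1 - δ) P(Ω)`. -/
lemma eventually_prob_mul_le_risk {Cl : ℝ} (hCl : 0 < Cl) {β : ℕ → ℝ}
    {Q : ∀ n : ℕ, Matrix (Fin n) (Fin n) ℝ} {A : ℕ → ℝ}
    {𝒞 𝒞' : ∀ n : ℕ, Finset (Finset (Fin n))} (hJ : ∀ n i j, 0 ≤ β n * Q n i j)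
    (hsub : ∀ n, 𝒞' n ⊆ 𝒞 n)
    (hdisj : ∀ n, (𝒞' n : Set (Finset (Fin n))).PairwiseDisjoint id)
    (hcard : ∀ᶠ n : ℕ in atTop, Cl * Real.log n ≤ Real.log ((𝒞' n).card : ℝ))
    {Ω : ∀ n : ℕ, Set (Spins n)} {r r' : ℕ → ℝ} (hup : ∀ n, IsUpperSet (Ω n))
    (hr' : Tendsto r' atTop atTop) (hrlog : ∀ᶠ n : ℕ in atTop, Real.log n ≤ r n)
    (hvar : ∀ᶠ n : ℕ in atTop, ∀ η ∈ Set.Icc 0 (A n), ∀ S ∈ 𝒞' n,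
      condVar (β n) (Q n) (blockField S (2 * η)) (Ω n) (blockSum S) ≤ r n)
    (hmix : ∀ ε : ℝ, 0 < ε → ∀ᶠ n : ℕ in atTop, ∀ η ∈ Set.Icc 0 (A n),
      ∀ S₁ ∈ 𝒞' n, ∀ S₂ ∈ 𝒞' n, S₁ ≠ S₂ →
        condVar (β n) (Q n) (blockField (S₁ ∪ S₂) η) (Ω n) (blockSum (S₁ ∪ S₂))
          - condVar (β n) (Q n) (blockField S₁ η) (Ω n) (blockSum S₁)
          - condVar (β n) (Q n) (blockField S₂ η) (Ω n) (blockSum S₂) ≤ ε * r' n)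
    (hA : ∀ᶠ n : ℕ in atTop, Real.tanh (A n)
      ≤ min (1 / 2) (√Cl / 4) * min (√(Real.log n / r n)) (√(1 / r' n)))
    {δ : ℝ} (hδ : 0 < δ) :
    ∀ᶠ n : ℕ in atTop, ∀ T : Test n,
      prob (β n) (Q n) 0 (Ω n) * (1 - δ) ≤ risk (β n) (Q n) (𝒞 n) (A n) T := by
  have hlog : Tendsto (fun n : ℕ => Real.log n) atTop atTop :=
    Real.tendsto_log_atTop.comp tendsto_natCast_atTop_atTop
  -- The `ε` for `hmix`: since `A² r' ≤ 1`, it makes the off-diagonal ratio at most `1 + δ ^ 2 / 2`.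
  -- The diagonal part gets the other `δ ^ 2 / 2`.
  have hε : 0 < 2 * Real.log (1 + δ ^ 2 / 2) :=
    mul_pos two_pos (Real.log_pos (by linarith [pow_pos hδ 2]))
  have hdecay : ∀ᶠ n : ℕ in atTop, Real.exp (-(Cl / 2 * Real.log n)) < δ ^ 2 / 2 :=
    (Real.tendsto_exp_neg_atTop_nhds_zero.comp
      (hlog.const_mul_atTop (half_pos hCl))).eventually_lt_const (by positivity)
  filter_upwards [hcard, hr'.eventually_gt_atTop 0, hrlog, hvar, hmix _ hε, hA, hdecay,
    hlog.eventually_gt_atTop 0] with n hcard hr' hrlog hvar hmix hA hdecay hlog T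
  -- As `Real.log 0 = 0`, an empty class would violate `hcard` once `log n > 0`.
  have hne : (𝒞' n).Nonempty := by
    rw [Finset.nonempty_iff_ne_empty]
    intro h
    rw [h, Finset.card_empty, Nat.cast_zero, Real.log_zero] at hcard
    nlinarith
  rcases le_or_gt (A n) 0 with hA0 | hA0
  · have h1 := one_le_risk_of_nonpos (β := β n) (Q := Q n) (hne.mono (hsub n)) hA0 T
    have h2 := prob_le_one (β n) (Q n) 0 (Ω n)
    have h3 := prob_nonneg (β n) (Q n) 0 (Ω n)
    nlinarith
  obtain ⟨hx, hy⟩ := signal_exponents_le hCl hlog hrlog hr' hA0 hA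
  refine le_trans ?_ (prob_mul_one_sub_le_risk (hJ n) (hsub n) (hdisj n) hne hA0 (hup n)
    (by positivity) hvar hmix T)
  refine mul_le_mul_of_nonneg_left (sub_le_sub_left ?_ 1) (prob_nonneg _ _ _ _)
  have hN : (0 : ℝ) < (𝒞' n).card := by exact_mod_cast hne.card_pos
  have hN2 : Real.exp (Cl * Real.log n) ≤ (𝒞' n).card := (Real.le_log_iff_exp_le hN).1 hcard
  refine Real.sqrt_le_iff.2 ⟨hδ.le, ?_⟩
  have t1 : Real.exp (2 * A n ^ 2 * r n) / (𝒞' n).card ≤ δ ^ 2 / 2 := by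
    calc Real.exp (2 * A n ^ 2 * r n) / (𝒞' n).card
        ≤ Real.exp (Cl / 2 * Real.log n) / Real.exp (Cl * Real.log n) := by gcongr
      _ = Real.exp (-(Cl / 2 * Real.log n)) := by rw [← Real.exp_sub]; ring_nf
      _ ≤ δ ^ 2 / 2 := hdecay.le
  have t2 : Real.exp (2 * Real.log (1 + δ ^ 2 / 2) * r' n * A n ^ 2 / 2) ≤ 1 + δ ^ 2 / 2 := by
    have hp : 0 < 1 + δ ^ 2 / 2 := by positivity
    refine (Real.le_log_iff_exp_le hp).1 ?_
    nlinarith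
  linarith

end Asymptotics

end IsingDetection

end

open IsingDetection in
theorem theorem3 (Cl : ℝ) (hCl : 0 < Cl) (Cu : ℝ) (hCu : 0 < Cu) :
    ∃ c' C : ℝ, 0 < c' ∧ 0 < C ∧
      ∀ (β : ℕ → ℝ) (Q : ∀ n : ℕ, Matrix (Fin n) (Fin n) ℝ)
        (s : ℕ → ℕ) (A : ℕ → ℝ) (𝒞 𝒞' : ∀ n : ℕ, Finset (Finset (Fin n))),
        (∀ n, (Q n).IsSymm) →
        (∀ n i, Q n i i = 0) →
        (∀ n i j, 0 ≤ β n * Q n i j) →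
        (∀ n, inftyOpNorm (Q n) ≤ Cu) →
        (∀ n, ∀ S ∈ 𝒞 n, S.card = s n) →
        (∀ n, 𝒞' n ⊆ 𝒞 n) →
        (∀ n, (𝒞' n : Set (Finset (Fin n))).PairwiseDisjoint id) →
        (∀ᶠ n : ℕ in atTop, Cl * Real.log n ≤ Real.log ((𝒞' n).card : ℝ)) →
        -- Part (I)
        (∀ r r' : ℕ → ℝ,
          Tendsto r atTop atTop →
          Tendsto r' atTop atTop →
          (∀ᶠ n : ℕ in atTop, C * Real.log n ≤ r n) →
          (∀ᶠ n : ℕ in atTop, ∀ S ∈ 𝒞' n, var (β n) (Q n) 0 (blockSum S) ≤ r n) →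
          (∀ ε : ℝ, 0 < ε → ∀ᶠ n : ℕ in atTop, ∀ S₁ ∈ 𝒞' n, ∀ S₂ ∈ 𝒞' n, S₁ ≠ S₂ →
            cov (β n) (Q n) 0 (blockSum S₁) (blockSum S₂) ≤ ε * r' n) →
          (∀ᶠ n : ℕ in atTop,
            Real.tanh (A n) ≤ c' * min (√(Real.log n / r n)) (√(1 / r' n))) →
          (∀ T : ∀ n : ℕ, Test n,
            AsympPowerless (fun n => risk (β n) (Q n) (𝒞 n) (A n) (T n))) ∧
          liminf (fun n => ⨅ T : Test n, risk (β n) (Q n) (𝒞 n) (A n) T) atTop = 1) ∧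
        -- Part (II)
        (∀ (Ω : ∀ n : ℕ, Set (Spins n)) (κ : ℝ) (r r' : ℕ → ℝ),
          (∀ n, IsUpperSet (Ω n)) →
          0 < κ →
          Tendsto r atTop atTop →
          Tendsto r' atTop atTop →
          (∀ᶠ n : ℕ in atTop, C * Real.log n ≤ r n) →
          (∀ᶠ n : ℕ in atTop, ∀ η ∈ Set.Icc 0 (A n), ∀ S ∈ 𝒞' n,
            condVar (β n) (Q n) (blockField S (2 * η)) (Ω n) (blockSum S) ≤ r n) →
          (∀ ε : ℝ, 0 < ε → ∀ᶠ n : ℕ in atTop, ∀ η ∈ Set.Icc 0 (A n),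
            ∀ S₁ ∈ 𝒞' n, ∀ S₂ ∈ 𝒞' n, S₁ ≠ S₂ →
              |condVar (β n) (Q n) (blockField (S₁ ∪ S₂) η) (Ω n) (blockSum (S₁ ∪ S₂))
                - condVar (β n) (Q n) (blockField S₁ η) (Ω n) (blockSum S₁)
                - condVar (β n) (Q n) (blockField S₂ η) (Ω n) (blockSum S₂)| ≤ ε * r' n) →
          κ ≤ liminf (fun n => prob (β n) (Q n) 0 (Ω n)) atTop →
          (∀ᶠ n : ℕ in atTop,
            Real.tanh (A n) ≤ c' * min (√(Real.log n / r n)) (√(1 / r' n))) →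
          ∀ T : ∀ n : ℕ, Test n,
            AsympNotPowerful (fun n => risk (β n) (Q n) (𝒞 n) (A n) (T n)) ∧
            ¬ AsympPowerful (fun n => risk (β n) (Q n) (𝒞 n) (A n) (T n))) := by
  -- `C = 1` and `c' ≤ 1 / 2` keep `tanh A ≤ 1 / 2`, whence `A ≤ 2 tanh A`. Then `c' ≤ √Cl / 4`
  -- makes the diagonal exponent at most half of `Cl * log n`.
  refine ⟨min (1 / 2) (√Cl / 4), 1, lt_min (by norm_num) (by positivity), one_pos, ?_⟩
  intro β Q s A 𝒞 𝒞' _ _ hJ _ _ hsub hdisj hcard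
  refine ⟨fun r r' _ hr' hrlog hvar hcov hA => ?_,
    fun Ω κ r r' hup hκ _ hr' hrlog hvar hmix hprob hA T => ?_⟩
  · have key : ∀ δ : ℝ, 0 < δ → ∀ᶠ n : ℕ in atTop, ∀ T : Test n,
        1 - δ ≤ risk (β n) (Q n) (𝒞 n) (A n) T := by
      intro δ hδ
      have h := eventually_prob_mul_le_risk hCl (Ω := fun n => Set.univ) (r := r) (r' := r') hJ
        hsub hdisj hcard (fun n => isUpperSet_univ) hr' (by simpa using hrlog)
        (by
          filter_upwards [hvar] with n hvar η hη S hS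
          rw [condVar_univ]
          exact (var_blockSum_le (hJ n) S (mul_nonneg zero_le_two hη.1)).trans (hvar S hS))
        -- `ε / 2`, because the covariance enters the variance of the union twice.
        (fun ε hε => by
          filter_upwards [hcov (ε / 2) (half_pos hε)] with n hcov η hη S₁ h₁ S₂ h₂ hne
          simp only [condVar_univ]
          have := var_blockSum_union_sub_le (hJ n) (show Disjoint S₁ S₂ from hdisj n h₁ h₂ hne) hη.1
          linarith [hcov S₁ h₁ S₂ h₂ hne]) hA hδ
      filter_upwards [h] with n h T
      have h1 : prob (β n) (Q n) 0 Set.univ = 1 := by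
        have := prob_add_prob_compl (β n) (Q n) 0 ∅
        rw [Set.compl_empty] at this
        simpa [prob, expect] using this
      simpa [h1] using h T
    constructor
    · intro T
      refine le_of_forall_sub_le fun δ hδ => ?_
      refine le_liminf_of_le
        (isBoundedUnder_of ⟨2, fun n => risk_le_two (T n)⟩).isCoboundedUnder_ge ?_
      filter_upwards [key δ hδ] with n h using h (T n)
    -- The test that always rejects has risk at most `1`.
    · have hle : ∀ n, ⨅ T : Test n, risk (β n) (Q n) (𝒞 n) (A n) T ≤ 1 := fun n =>
        (ciInf_le ⟨0, by rintro _ ⟨T, rfl⟩; exact risk_nonneg T⟩ _).trans risk_always_reject_le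
      refine le_antisymm ?_ (le_of_forall_sub_le fun δ hδ => ?_)
      · exact liminf_le_of_le
          (isBoundedUnder_of ⟨0, fun n => Real.iInf_nonneg fun T => risk_nonneg T⟩)
          fun b hb => by
            obtain ⟨n, hn⟩ := hb.exists
            exact hn.trans (hle n)
      · refine le_liminf_of_le (isBoundedUnder_of ⟨1, hle⟩).isCoboundedUnder_ge ?_
        filter_upwards [key δ hδ] with n h using le_ciInf h
  -- With `δ = 1 / 2` and eventually `P_0(Ω) > κ / 2`, the risk is at least `κ / 4`.
  · have h := eventually_prob_mul_le_risk hCl hJ hsub hdisj hcard hup hr' (by simpa using hrlog)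
      hvar (fun ε hε => by
        filter_upwards [hmix ε hε] with n h η hη S₁ h₁ S₂ h₂ hne
        exact (le_abs_self _).trans (h η hη S₁ h₁ S₂ h₂ hne)) hA one_half_pos
    have hκ' : ∀ᶠ n : ℕ in atTop, κ / 2 < prob (β n) (Q n) 0 (Ω n) :=
      eventually_lt_of_lt_liminf ((half_lt_self hκ).trans_le hprob)
        (isBoundedUnder_of ⟨0, fun n => prob_nonneg _ _ _ _⟩)
    have hbdd : IsBoundedUnder (· ≤ ·) atTop
        (fun n => risk (β n) (Q n) (𝒞 n) (A n) (T n)) :=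
      isBoundedUnder_of ⟨2, fun n => risk_le_two (T n)⟩
    have hpos : 0 < liminf (fun n => risk (β n) (Q n) (𝒞 n) (A n) (T n)) atTop := by
      refine lt_of_lt_of_le (by positivity : 0 < κ / 4) (le_liminf_of_le hbdd.isCoboundedUnder_ge ?_)
      filter_upwards [h, hκ'] with n h hκ'
      linarith [h (T n)]
    refine ⟨hpos, fun hpow => ?_⟩
    have := liminf_le_limsup hbdd (isBoundedUnder_of ⟨0, fun n => risk_nonneg (T n)⟩)
    exact absurd (hpow ▸ hpos.trans_le this) (lt_irrefl 0)
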